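/- \textbf{Theorem (Data cache capacity).} Let $N\ge 1$ be a perfect square and consider $P=\sqrt N$ cache slots which are all empty initially. In every time step (one per data request) a block is added to a uniformly random slot, and then random eviction with rate $2$ is performed: twice in succession, a uniformly random slot is selected, and one block is removed from it if it is non-empty (nothing happens if it is empty). All random choices, within and across time steps, are mutually independent. Let $Z(\vec 0,t)$ denote the total number of blocks in all slots (the client data cache) at the end of time step $t$. Let $k>0$ and $c>0$ be real numbers, let the number $M$ of data requests satisfy $M\le N^k$, and let $N$ be so large that $4(k+c)\ln N\le\sqrt N$ (for fixed $k$ and $c$, this holds for all sufficiently large $N$). Then $$\Pr\Big[\max_{1\le t\le M} Z(\vec 0,t) > \sqrt N+4\sqrt{k+c}\cdot N^{1/4}\sqrt{\ln N}\Big]\le \frac1{N^{c}}.$$ -/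

import Mathlib

open MeasureTheory ProbabilityTheory

namespace ORAM

/-- The contents of the client data cache, seen as the number of data blocks in each of its
`P` slots (one slot for every partition). -/
abbrev Slots (P : ℕ) : Type := Fin P → ℕ

/-- The random choices of one time step (one data request): the slot which receives the requested
block, and the `ν` slots that are selected for background eviction. -/
abbrev StepCoins (P ν : ℕ) : Type := Fin P × (Fin ν → Fin P)

/-- Put one block into slot `r`. -/
def place {P : ℕ} (s : Slots P) (r : Fin P) : Slots P :=
  Function.update s r (s r + 1)

/-- Evict one block from slot `r`. If the slot is empty only a dummy block is written to the
server, and the slot stays empty. -/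
def evict {P : ℕ} (s : Slots P) (r : Fin P) : Slots P :=
  if s r = 0 then s else Function.update s r (s r - 1)

/-- Random eviction with rate `ν`: evict successively from the `ν` slots
`r 0, …, r (ν - 1)`, which are sampled with replacement. -/
def randEvict {P ν : ℕ} (s : Slots P) (r : Fin ν → Fin P) : Slots P :=
  (List.ofFn r).foldl evict s

/-- One time step: the requested block is placed into a slot, then the background eviction runs. -/
def step {P ν : ℕ} (s : Slots P) (x : StepCoins P ν) : Slots P :=
  randEvict (place s x.1) x.2

/-- The slot loads after `t` time steps, started from the loads `s₀`; the coins of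
the `(t + 1)`-st time step are `x t`. -/
def load {P ν : ℕ} (s₀ : Slots P) (x : ℕ → StepCoins P ν) : ℕ → Slots P
  | 0 => s₀
  | t + 1 => step (load s₀ x t) (x t)

/-- `Z(s₀, t)`: the total number of blocks in the client data cache after `t` time steps. -/
def cacheSize {P ν : ℕ} (s₀ : Slots P) (x : ℕ → StepCoins P ν) (t : ℕ) : ℕ :=
  ∑ i, load s₀ x t i

/-- The coins of the time steps are independent, and in each time step the slot for the requested
block and the `ν` slots to evict from are independent and uniformly random: the joint law of these
`ν + 1` slots is the uniform distribution on all `(ν + 1)`-tuples of slots. -/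
structure IsUniformCoins {P ν : ℕ} {Ω : Type*} [MeasurableSpace Ω] (μ : Measure Ω)
    (x : ℕ → Ω → StepCoins P ν) : Prop where
  measurable : ∀ t, Measurable (x t)
  indep : iIndepFun x μ
  law : ∀ t, μ.map (x t) = uniformOn Set.univ

end ORAM

namespace ORAM

/-! The slot loads are dependent, but their joint upper tails are dominated by those of independent
geometric variables: `Pr[j ≤ load] ≤ 2 ^ (-∑ j i)` for every threshold vector `j`, uniformly in time
(`measureReal_le_load`). Induction on time works by pulling thresholds back through one step: a
placement lowers a threshold, an eviction raises a positive one, and on average `geomTail` does not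
grow (`sum_geomTail_step_le`). For `a ≥ 0`, `(1 + a) ^ Z` is a nonnegative combination of indicators
of the events `j ≤ load`, so its mean is at most the geometric value `(1 / (1 - a)) ^ P`. Markov's
inequality and a union bound over the time steps finish the proof. -/

/-! ### Pulling thresholds back through a time step -/

/-- The thresholds which the loads must meet before one block is put into slot `r` so that they
meet the thresholds `j` afterwards. -/
def lower {P : ℕ} (j : Slots P) (r : Fin P) : Slots P :=
  Function.update j r (j r - 1)

/-- The thresholds which the loads must meet before an eviction from slot `r` so that they meet the
thresholds `j` afterwards. -/
def raise {P : ℕ} (j : Slots P) (r : Fin P) : Slots P :=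
  if j r = 0 then j else Function.update j r (j r + 1)

theorem le_place_iff {P : ℕ} (j s : Slots P) (r : Fin P) :
    j ≤ place s r ↔ lower j r ≤ s := by
  simp only [Pi.le_def, place, lower]
  refine forall_congr' fun i => ?_
  by_cases h : i = r
  · subst h; simp
  · simp [h]

theorem le_evict_iff {P : ℕ} (j s : Slots P) (r : Fin P) :
    j ≤ evict s r ↔ raise j r ≤ s := by
  simp only [Pi.le_def]
  refine forall_congr' fun i => ?_
  unfold evict raise
  by_cases h : i = r
  · subst h
    split_ifs <;> simp <;> omega
  · split_ifs <;> simp [h]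

theorem le_step_iff {P : ℕ} (j s : Slots P) (y : StepCoins P 2) :
    j ≤ step s y ↔ lower (raise (raise j (y.2 1)) (y.2 0)) y.1 ≤ s := by
  have : step s y = evict (evict (place s y.1) (y.2 0)) (y.2 1) := by
    simp [step, randEvict]
  rw [this, le_evict_iff, le_evict_iff, le_place_iff]

/-! ### The geometric product tail and its average over one step -/

/-- The number of slots with a positive threshold. -/
def posCount {P : ℕ} (j : Slots P) : ℕ := (Finset.univ.filter fun i => j i ≠ 0).card

/-- The probability that independent geometric loads with ratio `1/2` meet the thresholds `j`. -/
noncomputable def geomTail {P : ℕ} (j : Slots P) : ℝ := ∏ i, (1 / 2 : ℝ) ^ j i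

theorem geomTail_nonneg {P : ℕ} (j : Slots P) : 0 ≤ geomTail j :=
  Finset.prod_nonneg fun _ _ => by positivity

theorem geomTail_update {P : ℕ} (j : Slots P) (r : Fin P) (n : ℕ) :
    geomTail (Function.update j r n) * (1 / 2) ^ j r = geomTail j * (1 / 2) ^ n := by
  have h1 := Finset.mul_prod_erase Finset.univ (fun i => (1 / 2 : ℝ) ^ j i) (Finset.mem_univ r)
  have h2 := Finset.mul_prod_erase Finset.univ
    (fun i => (1 / 2 : ℝ) ^ (Function.update j r n) i) (Finset.mem_univ r)
  have h3 : ∏ i ∈ Finset.univ.erase r, (1 / 2 : ℝ) ^ (Function.update j r n) i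
      = ∏ i ∈ Finset.univ.erase r, (1 / 2 : ℝ) ^ j i :=
    Finset.prod_congr rfl fun i hi => by
      rw [Function.update_of_ne (Finset.ne_of_mem_erase hi)]
  unfold geomTail
  rw [← h1, ← h2, h3, Function.update_self]
  ring

theorem geomTail_lower {P : ℕ} (j : Slots P) (r : Fin P) :
    geomTail (lower j r) = geomTail j * (1 + if j r ≠ 0 then 1 else 0) := by
  by_cases h : j r = 0
  · have : lower j r = j := by
      rw [lower, h, Nat.zero_sub, ← h, Function.update_eq_self]
    simp [this, h]
  · have := geomTail_update j r (j r - 1)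
    obtain ⟨n, hn⟩ := Nat.exists_eq_succ_of_ne_zero h
    rw [hn, Nat.succ_sub_one, pow_succ] at this
    have hp : (0 : ℝ) < (1 / 2) ^ n := by positivity
    rw [lower, hn, Nat.succ_sub_one]
    simp only [ne_eq, Nat.succ_ne_zero, not_false_eq_true, if_true]
    refine mul_right_cancel₀ hp.ne' ?_
    linarith

theorem geomTail_raise {P : ℕ} (j : Slots P) (r : Fin P) :
    geomTail (raise j r) = geomTail j * (1 - (1 / 2) * if j r ≠ 0 then 1 else 0) := by
  by_cases h : j r = 0
  · simp [raise, h]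
  · have := geomTail_update j r (j r + 1)
    have hp : (0 : ℝ) < (1 / 2) ^ j r := by positivity
    rw [pow_succ] at this
    simp only [raise, h, if_false, ne_eq, not_false_eq_true, if_true]
    refine mul_right_cancel₀ hp.ne' ?_
    linarith

theorem posCount_raise {P : ℕ} (j : Slots P) (r : Fin P) : posCount (raise j r) = posCount j := by
  unfold posCount raise
  congr 1
  ext i
  by_cases h : i = r
  · subst h
    split_ifs <;> simp_all
  · split_ifs <;> simp [h]

theorem sum_posCount {P : ℕ} (j : Slots P) :
    ∑ r, (if j r ≠ 0 then (1 : ℝ) else 0) = posCount j := by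
  rw [posCount, Finset.natCast_card_filter]

theorem sum_geomTail_lower {P : ℕ} (j : Slots P) :
    ∑ r, geomTail (lower j r) = geomTail j * (P + posCount j) := by
  simp only [geomTail_lower]
  rw [← Finset.mul_sum, Finset.sum_add_distrib, sum_posCount]
  simp

theorem sum_geomTail_raise {P : ℕ} (j : Slots P) :
    ∑ r, geomTail (raise j r) = geomTail j * (P - posCount j / 2) := by
  simp only [geomTail_raise]
  rw [← Finset.mul_sum, Finset.sum_sub_distrib, ← Finset.mul_sum, sum_posCount]
  simp
  left; ring

/-- With `m = posCount j`, each eviction contributes the factor `P - m / 2` and the placement `P +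
m`; raising keeps `m` fixed, so the factors multiply. -/
theorem sum_geomTail_step_le {P : ℕ} (j : Slots P) :
    ∑ y : StepCoins P 2, geomTail (lower (raise (raise j (y.2 1)) (y.2 0)) y.1)
      ≤ P ^ 3 * geomTail j := by
  have e : ∑ y : StepCoins P 2, geomTail (lower (raise (raise j (y.2 1)) (y.2 0)) y.1)
      = ∑ b, ∑ a, ∑ r, geomTail (lower (raise (raise j b) a) r) := by
    rw [Fintype.sum_prod_type_right, ← Equiv.sum_comp (finTwoArrowEquiv (Fin P)).symm,
      Fintype.sum_prod_type_right]
    simp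
  have hm : (posCount j : ℝ) ≤ P := by
    have : posCount j ≤ Finset.card (Finset.univ : Finset (Fin P)) := Finset.card_filter_le _ _
    rw [Finset.card_univ, Fintype.card_fin] at this
    exact_mod_cast this
  have hm0 : (0 : ℝ) ≤ posCount j := Nat.cast_nonneg _
  simp only [e, sum_geomTail_lower, posCount_raise, ← Finset.sum_mul, sum_geomTail_raise]
  have hg := geomTail_nonneg j
  -- The terms linear in `m` cancel at eviction rate 2, leaving `P ^ 3 - (3 / 4) * P * m ^ 2 + m ^ 3
  -- / 4`, and `m ≤ P`.
  have key : ((P : ℝ) - posCount j / 2) * (P - posCount j / 2) * (P + posCount j) ≤ P ^ 3 := by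
    nlinarith [mul_nonneg (mul_nonneg hm0 hm0) (sub_nonneg.2 hm), pow_nonneg hm0 3,
      mul_nonneg (mul_nonneg hm0 hm0) (Nat.cast_nonneg (α := ℝ) P)]
  calc _ = geomTail j * (((P : ℝ) - posCount j / 2) * (P - posCount j / 2) * (P + posCount j)) := by
        ring
    _ ≤ geomTail j * P ^ 3 := by gcongr
    _ = _ := by ring

/-- Dependence on the earlier coins only is what makes the load at time `t` independent of `x t`. -/
theorem exists_load_eq {P ν : ℕ} (s₀ : Slots P) (t : ℕ) :
    ∃ g : (Finset.range t → StepCoins P ν) → Slots P,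
      ∀ x : ℕ → StepCoins P ν, load s₀ x t = g fun i => x i := by
  induction t with
  | zero => exact ⟨fun _ => s₀, fun _ => rfl⟩
  | succ t ih =>
    obtain ⟨g, hg⟩ := ih
    refine ⟨fun y => step (g fun i => y ⟨i, ?_⟩) (y ⟨t, Finset.self_mem_range_succ t⟩), fun x => ?_⟩
    · have := Finset.mem_range.1 i.2
      exact Finset.mem_range.2 (by omega)
    · simp only [load, hg]

/-- This crude bound keeps the later expansion over thresholds finite. -/
theorem load_le {P : ℕ} (x : ℕ → StepCoins P 2) (t : ℕ) (i : Fin P) : load 0 x t i ≤ t := by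
  induction t with
  | zero => simp [load]
  | succ t ih =>
    have he : ∀ (s : Slots P) (r : Fin P), evict s r i ≤ s i := by
      intro s r
      unfold evict
      by_cases h : i = r
      · subst h; split_ifs <;> simp
      · split_ifs <;> simp [h]
    have hp : ∀ (s : Slots P) (r : Fin P), place s r i ≤ s i + 1 := by
      intro s r
      unfold place
      by_cases h : i = r
      · subst h; simp
      · simp [h]
    have : load 0 x (t + 1) =
        evict (evict (place (load 0 x t) (x t).1) ((x t).2 0)) ((x t).2 1) := by
      simp [load, step, randEvict]
    rw [this]
    exact (he _ _).trans ((he _ _).trans ((hp _ _).trans (by omega)))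

/-! ### Domination of the load tails by geometric tails -/

section Probability

variable {Ω : Type*} [MeasurableSpace Ω] {μ : Measure Ω} {P ν : ℕ}
  {x : ℕ → Ω → StepCoins P ν}

theorem IsUniformCoins.measurable_load (hx : IsUniformCoins μ x) (s₀ : Slots P) (t : ℕ) :
    Measurable fun ω => load s₀ (fun s => x s ω) t := by
  obtain ⟨g, hg⟩ := exists_load_eq (ν := ν) s₀ t
  simp only [hg]
  exact (Measurable.of_discrete (f := g)).comp (measurable_pi_lambda _ fun i => hx.measurable i)

theorem IsUniformCoins.indepFun_load (hx : IsUniformCoins μ x) (s₀ : Slots P) (t : ℕ) :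
    IndepFun (fun ω => load s₀ (fun s => x s ω) t) (x t) μ := by
  obtain ⟨g, hg⟩ := exists_load_eq (ν := ν) s₀ t
  simp only [hg]
  have h := hx.indep.indepFun_finset (Finset.range t) {t} (by simp) hx.measurable
  exact h.comp (φ := g) (ψ := fun y : ((({t} : Finset ℕ)) → StepCoins P ν) =>
    y ⟨t, Finset.mem_singleton_self t⟩) Measurable.of_discrete Measurable.of_discrete

theorem IsUniformCoins.measureReal_eq (hx : IsUniformCoins μ x) (t : ℕ) (y : StepCoins P ν) :
    μ.real (x t ⁻¹' {y}) = 1 / (P : ℝ) ^ (ν + 1) := by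
  have h : μ (x t ⁻¹' {y}) = uniformOn Set.univ {y} := by
    rw [← hx.law t, Measure.map_apply (hx.measurable t) (MeasurableSet.of_discrete)]
  rw [measureReal_def, h, uniformOn_univ]
  simp [pow_succ]
  ring

theorem IsUniformCoins.measureReal_load_succ [IsProbabilityMeasure μ]
    (hx : IsUniformCoins μ x) (s₀ : Slots P) (t : ℕ)
    (A : Set (Slots P)) :
    μ.real {ω | load s₀ (fun s => x s ω) (t + 1) ∈ A} =
      (1 / (P : ℝ) ^ (ν + 1)) *
        ∑ y : StepCoins P ν, μ.real {ω | step (load s₀ (fun s => x s ω) t) y ∈ A} := by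
  have hd : {ω | load s₀ (fun s => x s ω) (t + 1) ∈ A} =
      ⋃ y ∈ (Finset.univ : Finset (StepCoins P ν)),
        ((fun ω => load s₀ (fun s => x s ω) t) ⁻¹' {s | step s y ∈ A} ∩ x t ⁻¹' {y}) := by
    ext ω
    simp [load]
  rw [hd, measureReal_biUnion_finset, Finset.mul_sum]
  · refine Finset.sum_congr rfl fun y _ => ?_
    have := (hx.indepFun_load s₀ t).measure_inter_preimage_eq_mul {s | step s y ∈ A} {y}
      MeasurableSet.of_discrete MeasurableSet.of_discrete
    rw [measureReal_def, this, ENNReal.toReal_mul, ← measureReal_def, ← measureReal_def,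
      hx.measureReal_eq, mul_comm]
    rfl
  · intro y _ z _ hyz
    refine Set.disjoint_left.2 fun ω h1 h2 => hyz ?_
    exact h1.2.symm.trans h2.2
  · intro y _
    exact (hx.measurable_load s₀ t MeasurableSet.of_discrete).inter
      (hx.measurable t MeasurableSet.of_discrete)

theorem IsUniformCoins.measureReal_le_load [IsProbabilityMeasure μ]
    {x : ℕ → Ω → StepCoins P 2} (hx : IsUniformCoins μ x)
    (hP : 0 < P) (t : ℕ) (j : Slots P) :
    μ.real {ω | j ≤ load 0 (fun s => x s ω) t} ≤ geomTail j := by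
  -- The thresholds must vary, since the step replaces `j` by its pullbacks.
  induction t generalizing j with
  | zero =>
    by_cases h : j = 0
    · subst h
      simp [geomTail, load]
    · have : {ω | j ≤ load 0 (fun s => x s ω) 0} = ∅ := by
        ext ω
        simp only [load, Set.mem_ofPred_eq, Set.mem_empty_iff_false, iff_false]
        exact fun h' => h (le_antisymm h' (zero_le (a := j)))
      rw [this, measureReal_empty]
      exact geomTail_nonneg j
  | succ t ih =>
    have h := hx.measureReal_load_succ 0 t (Set.Ici j)
    simp only [Set.mem_Ici, le_step_iff] at h
    rw [h]
    have hP' : (0 : ℝ) < P := by exact_mod_cast hP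
    calc _ ≤ (1 / (P : ℝ) ^ 3) * (P ^ 3 * geomTail j) := by
          gcongr
          exact (Finset.sum_le_sum fun y _ => ih _).trans (sum_geomTail_step_le j)
      _ = geomTail j := by field_simp

/-! ### Exponential moment of the cache size -/

/-- The weights with `∑ j ≤ n, increment a j = (1 + a) ^ n`. -/
def increment (a : ℝ) : ℕ → ℝ
  | 0 => 1
  | n + 1 => a * (1 + a) ^ n

theorem increment_nonneg {a : ℝ} (ha : 0 ≤ a) (n : ℕ) : 0 ≤ increment a n := by
  cases n <;> simp only [increment] <;> positivity

theorem sum_increment (a : ℝ) (n : ℕ) :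
    ∑ j ∈ Finset.range (n + 1), increment a j = (1 + a) ^ n := by
  induction n with
  | zero => simp [increment]
  | succ n ih => rw [Finset.sum_range_succ, ih, increment]; ring

/-- Summation by parts: the full series is the mean of `(1 + a) ^ G` for `G` geometric with `Pr[G ≥
j] = 2 ^ (-j)`. -/
theorem sum_increment_mul_half_pow_le {a : ℝ} (ha : 0 ≤ a) (ha1 : a < 1) (n : ℕ) :
    ∑ j ∈ Finset.range n, increment a j * (1 / 2) ^ j ≤ 1 / (1 - a) := by
  have h1 : 0 < 1 - a := by linarith
  have key : ∑ j ∈ Finset.range (n + 1), increment a j * (1 / 2) ^ j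
      = 1 / (1 - a) - a / (1 - a) * ((1 + a) / 2) ^ n := by
    induction n with
    | zero => simp [increment]; field_simp
    | succ n ih =>
      rw [Finset.sum_range_succ, ih, increment, div_pow, div_pow, div_pow]
      field_simp
      ring
  calc _ ≤ ∑ j ∈ Finset.range (n + 1), increment a j * (1 / 2) ^ j := by
        rw [Finset.sum_range_succ]
        have := increment_nonneg ha n
        have : 0 ≤ increment a n * (1 / 2) ^ n := by positivity
        linarith
    _ ≤ _ := by
        rw [key]
        have : 0 ≤ a / (1 - a) * ((1 + a) / 2) ^ n := by positivity
        linarith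

/-- Each factor `(1 + a) ^ s i` telescopes over thresholds; multiplying out gives joint tail events,
the only events whose probability is controlled. -/
theorem one_add_pow_sum_eq (a : ℝ) (s : Slots P) (t : ℕ) (hs : ∀ i, s i ≤ t) :
    (1 + a) ^ (∑ i, s i) = ∑ j ∈ Fintype.piFinset fun _ : Fin P => Finset.range (t + 1),
      (∏ i, increment a (j i)) * Set.indicator {s | j ≤ s} 1 s := by
  have h (i : Fin P) : (1 + a) ^ s i = ∑ j ∈ Finset.range (t + 1),
      increment a j * if j ≤ s i then 1 else 0 := by
    rw [← sum_increment]
    simp only [mul_ite, mul_one, mul_zero]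
    rw [← Finset.sum_filter]
    refine Finset.sum_congr ?_ fun _ _ => rfl
    ext j
    have := hs i
    simp only [Finset.mem_range, Finset.mem_filter]
    omega
  rw [← Finset.prod_pow_eq_pow_sum]
  simp only [h]
  rw [Finset.prod_univ_sum]
  refine Finset.sum_congr rfl fun j _ => ?_
  rw [Finset.prod_mul_distrib]
  congr 1
  by_cases hj : j ≤ s
  · have hj' : ∀ i, j i ≤ s i := hj
    simp [hj, hj']
  · rw [Set.indicator_of_notMem (by simpa using hj)]
    rw [Pi.le_def] at hj
    push Not at hj
    obtain ⟨i, hi⟩ := hj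
    exact Finset.prod_eq_zero (Finset.mem_univ i) (by simp [hi])

theorem IsUniformCoins.integrable_and_integral_pow_cacheSize_le [IsProbabilityMeasure μ]
    {x : ℕ → Ω → StepCoins P 2}
    (hx : IsUniformCoins μ x) (hP : 0 < P) (t : ℕ) {a : ℝ} (ha : 0 ≤ a) (ha1 : a < 1) :
    Integrable (fun ω => (1 + a) ^ cacheSize 0 (fun s => x s ω) t) μ ∧
      ∫ ω, (1 + a) ^ cacheSize 0 (fun s => x s ω) t ∂μ ≤ (1 / (1 - a)) ^ P := by
  have hm (j : Slots P) : MeasurableSet {ω | j ≤ load 0 (fun s => x s ω) t} :=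
    hx.measurable_load 0 t (MeasurableSet.of_discrete (s := Set.Ici j))
  have e : (fun ω => (1 + a) ^ cacheSize 0 (fun s => x s ω) t) = fun ω =>
      ∑ j ∈ Fintype.piFinset fun _ : Fin P => Finset.range (t + 1),
        (∏ i, increment a (j i)) *
          Set.indicator {ω | j ≤ load 0 (fun s => x s ω) t} (1 : Ω → ℝ) ω := by
    ext ω
    exact one_add_pow_sum_eq a _ t (load_le _ t)
  have hi (j : Slots P) : Integrable (fun ω => (∏ i, increment a (j i)) *
      Set.indicator {ω | j ≤ load 0 (fun s => x s ω) t} (1 : Ω → ℝ) ω) μ :=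
    ((integrable_const (1 : ℝ)).indicator (hm j)).const_mul _
  rw [e]
  refine ⟨integrable_finsetSum _ fun j _ => hi j, ?_⟩
  rw [integral_finsetSum _ fun j _ => hi j]
  calc _ ≤ ∑ j ∈ Fintype.piFinset fun _ : Fin P => Finset.range (t + 1),
          ∏ i, (increment a (j i) * (1 / 2) ^ j i) := by
        refine Finset.sum_le_sum fun j _ => ?_
        rw [integral_const_mul, integral_indicator_one (hm j), Finset.prod_mul_distrib]
        exact mul_le_mul_of_nonneg_left (hx.measureReal_le_load hP t j)
          (Finset.prod_nonneg fun i _ => increment_nonneg ha _)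
    _ = ∏ _i : Fin P, ∑ j ∈ Finset.range (t + 1), increment a j * (1 / 2) ^ j := by
        rw [Finset.prod_univ_sum]
    _ ≤ ∏ _i : Fin P, 1 / (1 - a) :=
        Finset.prod_le_prod
          (fun _ _ => Finset.sum_nonneg fun j _ =>
            mul_nonneg (increment_nonneg ha j) (by positivity))
          fun _ _ => sum_increment_mul_half_pow_le ha ha1 _
    _ = _ := by simp

/-! ### Chernoff bound and union bound -/

/-- This is the Chernoff exponent per slot. It equals `log (1 - a ^ 2) + 4 * a * log (1 + a)`;
applying `log y ≥ 1 - 1 / y` to both logarithms gives at least `-(4 / 3) * a ^ 2 + (8 / 3) * a ^ 2`.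
-/
theorem sq_le_log_add_log {a : ℝ} (ha : 0 ≤ a) (ha2 : a ≤ 1 / 2) :
    a ^ 2 ≤ Real.log (1 - a) + (1 + 4 * a) * Real.log (1 + a) := by
  have h1 : 0 < 1 - a := by linarith
  have h2 : 0 < 1 + a := by linarith
  have h3 := Real.one_sub_inv_le_log_of_pos (mul_pos h1 h2)
  rw [Real.log_mul h1.ne' h2.ne'] at h3
  have h4 := Real.one_sub_inv_le_log_of_pos h2
  have h5 : ((1 - a) * (1 + a))⁻¹ ≤ 1 + 4 / 3 * a ^ 2 := by
    rw [inv_le_iff_one_le_mul₀ (mul_pos h1 h2)]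
    nlinarith [mul_nonneg (sq_nonneg a) (sub_nonneg.2 ha2), mul_nonneg (mul_nonneg ha
      (sq_nonneg a)) (sub_nonneg.2 ha2)]
  have h6 : (1 + a)⁻¹ ≤ 1 - 2 / 3 * a := by
    rw [inv_le_iff_one_le_mul₀ h2]
    nlinarith
  have h7 : 4 * a * (2 / 3 * a) ≤ 4 * a * Real.log (1 + a) := by
    gcongr
    linarith
  nlinarith [sq_nonneg a]

theorem IsUniformCoins.measureReal_lt_cacheSize_le [IsProbabilityMeasure μ]
    {x : ℕ → Ω → StepCoins P 2}
    (hx : IsUniformCoins μ x) (hP : 0 < P) (t : ℕ) {a : ℝ} (ha : 0 ≤ a) (ha2 : a ≤ 1 / 2) :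
    μ.real {ω | (P : ℝ) + 4 * a * P < cacheSize 0 (fun s => x s ω) t}
      ≤ Real.exp (-(P * a ^ 2)) := by
  obtain ⟨hint, hle⟩ := hx.integrable_and_integral_pow_cacheSize_le hP t ha (by linarith)
  have h1 : 0 < 1 - a := by linarith
  have h2 : 0 < 1 + a := by linarith
  have hmk := mul_meas_ge_le_integral_of_nonneg (μ := μ)
    (Filter.Eventually.of_forall fun ω => by positivity) hint ((1 + a) ^ ((P : ℝ) + 4 * a * P))
  have hsub : {ω | (P : ℝ) + 4 * a * P < cacheSize 0 (fun s => x s ω) t} ⊆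
      {ω | (1 + a) ^ ((P : ℝ) + 4 * a * P) ≤ (1 + a) ^ cacheSize 0 (fun s => x s ω) t} := by
    intro ω hω
    have := Real.rpow_le_rpow_of_exponent_le (show 1 ≤ 1 + a by linarith) (le_of_lt hω)
    rwa [Real.rpow_natCast] at this
  have hpos : 0 < (1 + a) ^ ((P : ℝ) + 4 * a * P) := by positivity
  have h3 := (mul_le_mul_of_nonneg_left (measureReal_mono (μ := μ) hsub) hpos.le).trans
    (hmk.trans hle)
  refine le_of_mul_le_mul_left (h3.trans ?_) hpos
  rw [Real.rpow_def_of_pos h2, ← Real.exp_add, ← Real.exp_log (one_div_pos.2 h1),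
    ← Real.exp_nat_mul, Real.exp_le_exp, one_div, Real.log_inv]
  have hP' : (0 : ℝ) ≤ P := Nat.cast_nonneg P
  nlinarith [mul_le_mul_of_nonneg_left (sq_le_log_add_log ha ha2) hP']

end Probability

end ORAM

theorem theoremA5 {Ω : Type*} [MeasurableSpace Ω] (μ : Measure Ω) [IsProbabilityMeasure μ]
    (N P M : ℕ) (hP : 0 < P) (hN : P ^ 2 = N)
    (x : ℕ → Ω → ORAM.StepCoins P 2) (hx : ORAM.IsUniformCoins μ x)
    (k c : ℝ) (hk : 0 < k) (hc : 0 < c) (hM : (M : ℝ) ≤ (N : ℝ) ^ k)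
    (hlarge : 4 * (k + c) * Real.log N ≤ Real.sqrt N) :
    μ.real {ω | ∃ t ∈ Finset.Icc 1 M,
        Real.sqrt N + 4 * Real.sqrt (k + c) * (N : ℝ) ^ (1 / 4 : ℝ) * Real.sqrt (Real.log N)
          < (ORAM.cacheSize 0 (fun s => x s ω) t : ℝ)}
      ≤ 1 / (N : ℝ) ^ c := by
  have hP' : (0 : ℝ) < P := by exact_mod_cast hP
  have hNP : (N : ℝ) = (P : ℝ) ^ 2 := by rw [← hN]; push_cast; rfl
  have hN0 : (0 : ℝ) < N := by rw [hNP]; positivity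
  have hsq : Real.sqrt N = P := by rw [hNP, Real.sqrt_sq hP'.le]
  have hN4 : (N : ℝ) ^ (1 / 4 : ℝ) = Real.sqrt P := by
    rw [hNP, Real.sqrt_eq_rpow, ← Real.rpow_natCast, ← Real.rpow_mul hP'.le]
    norm_num
  have hlog : 0 ≤ Real.log N := Real.log_natCast_nonneg N
  have hkc : 0 < k + c := by linarith
  rw [hsq] at hlarge ⊢
  rw [hN4]
  -- Chosen so that `exp (-(P * a ^ 2)) = N ^ (-(k + c))`, while `4 * a * P` is exactly the allowed
  -- excess.
  set a : ℝ := Real.sqrt ((k + c) * Real.log N / P) with ha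
  have hL : 0 ≤ (k + c) * Real.log N := by positivity
  have ha0 : 0 ≤ a := Real.sqrt_nonneg _
  have hasq : P * a ^ 2 = (k + c) * Real.log N := by
    rw [ha, Real.sq_sqrt (by positivity)]
    field_simp
  -- This is where `hlarge` enters: it says `4 * a ^ 2 ≤ 1`.
  have ha2 : a ≤ 1 / 2 := by
    refine abs_le_of_sq_le_sq' ?_ (by norm_num) |>.2
    nlinarith
  have hthr : 4 * Real.sqrt (k + c) * Real.sqrt P * Real.sqrt (Real.log N) = 4 * a * P := by
    have hs : Real.sqrt P * Real.sqrt P = P := Real.mul_self_sqrt hP'.le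
    have hs0 : Real.sqrt P ≠ 0 := (Real.sqrt_pos.2 hP').ne'
    rw [ha, Real.sqrt_div hL, Real.sqrt_mul hkc.le]
    field_simp
    linear_combination Real.sqrt (Real.log N) * hs
  rw [hthr]
  have hset : {ω | ∃ t ∈ Finset.Icc 1 M,
      (P : ℝ) + 4 * a * P < (ORAM.cacheSize 0 (fun s => x s ω) t : ℝ)} =
      ⋃ t ∈ Finset.Icc 1 M,
        {ω | (P : ℝ) + 4 * a * P < (ORAM.cacheSize 0 (fun s => x s ω) t : ℝ)} := by
    ext ω
    simp
  rw [hset]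
  calc _ ≤ ∑ t ∈ Finset.Icc 1 M,
        μ.real {ω | (P : ℝ) + 4 * a * P < (ORAM.cacheSize 0 (fun s => x s ω) t : ℝ)} :=
        measureReal_biUnion_finset_le _ _
    _ ≤ ∑ _t ∈ Finset.Icc 1 M, Real.exp (-(P * a ^ 2)) :=
        Finset.sum_le_sum fun t _ => hx.measureReal_lt_cacheSize_le hP t ha0 ha2
    _ = M * (N : ℝ) ^ (-(k + c)) := by
        rw [Finset.sum_const, Nat.card_Icc, nsmul_eq_mul, hasq, Real.rpow_def_of_pos hN0]
        congr 2
        ring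
    _ ≤ (N : ℝ) ^ k * (N : ℝ) ^ (-(k + c)) := by gcongr
    _ = 1 / (N : ℝ) ^ c := by
        rw [← Real.rpow_add hN0, one_div, ← Real.rpow_neg hN0.le]
        congr 1
        ring
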